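/- Let $R$ be an integral domain with quotient field $K$. A finitely generated ideal $J$ of $R$ is a GV-ideal if the natural map $R\to\operatorname{Hom}_R(J,R)$, sending $r$ to multiplication by $r$, is an isomorphism; an $R$-module is GV-torsion if each of its elements is annihilated by some GV-ideal. An ideal $I$ of $R$ is a $w$-ideal if $I=\{x\in K : Jx\subseteq I \text{ for some GV-ideal } J\}$, and $w\text{-}\mathrm{Max}(R)$ is the set of maximal elements among the proper $w$-ideals; these are prime ideals. A sequence of $R$-modules is $w$-exact if it becomes exact after localizing at every $\mathfrak m\in w\text{-}\mathrm{Max}(R)$. An $R$-module $F$ is $w$-flat if $\operatorname{Tor}_1^R(N,F)$ is GV-torsion for every $R$-module $N$. The $w$-flat dimension of an $R$-module $M$ is the least $n\ge 0$ for which there is a $w$-exact sequence $0\to F_n\to\cdots\to F_0\to M\to 0$ with all $F_i$ $w$-flat ($\infty$ if there is none), and the $w$-weak global dimension of $R$ is the supremum of the $w$-flat dimensions of all $R$-modules. The domain $R$ is a Prüfer $v$-multiplication domain (P$v$MD) if every nonzero finitely generated ideal $I$ of $R$ is $t$-invertible, that is, $(II^{-1})_t=R$; here $X^{-1}=\{x\in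 K: xX\subseteq R\}$ for a nonzero fractional ideal $X$, and $X_t$ is the union of the $(F^{-1})^{-1}$ over the nonzero finitely generated fractional ideals $F\subseteq X$. The following are equivalent. 1. $R$ is a P$v$MD. 2. $\operatorname{Tor}_2^R(M,N)$ is GV-torsion for all $R$-modules $M,N$. 3. The $w$-weak global dimension of $R$ is at most $1$. 4. $\operatorname{Tor}_1^R(X,A)$ is GV-torsion for every $R$-module $X$ and every torsion-free $R$-module $A$. 5. For all (associative, unital, not necessarily commutative) $K$-algebras $T,S$ and all $R$-subalgebras $A\subseteq T$, $B\subseteq S$, the canonical map $\mu_{A,B}\colon A\otimes_R B\to T\otimes_K S$, $a\otimes b\mapsto a\otimes b$, has GV-torsion kernel. 6. For all $K$-algebras $T,S$ and all $R$-subalgebras $A\subseteq T$, $B\subseteq S$ as in 5, the localization $(\mu_{A,B})_{\mathfrak m}$ is injective for every $\mathfrak m\in w\text{-}\mathrm{Max}(R)$. Moreover, for each individual choice of $T,S,A,B$ as in 5, the kernel of $\mu_{A,B}$ is GV-torsion if and only if $(\mu_{A,B})_{\mathfrak m}$ is injective for every $\mathfrak m\in w\text{-}\mathrm{Max}(R)$.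 -/

import Mathlib

open scoped TensorProduct nonZeroDivisors
open CategoryTheory

universe u v

noncomputable section

namespace WModule

/-! ### GV-ideals and GV-torsion modules -/

section GV

variable {R : Type u} [CommRing R]

/-- A finitely generated ideal `J` is a GV-ideal if the natural map `R → Hom_R(J, R)`,
sending `r` to multiplication by `r`, is an isomorphism. -/
def IsGVIdeal (J : Ideal R) : Prop :=
  J.FG ∧ Function.Bijective
    (LinearMap.toSpanSingleton R (J →ₗ[R] R) (Submodule.subtype J))

/-- A module is GV-torsion if each of its elements is killed by some GV-ideal. -/
def IsGVTorsion (R : Type u) [CommRing R] (M : Type v) [AddCommGroup M] [Module R M] : Prop :=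
  ∀ x : M, ∃ J : Ideal R, IsGVIdeal J ∧ ∀ a ∈ J, a • x = 0

end GV

/-! ### `w`-ideals and maximal `w`-ideals -/

section WIdeals

variable {R : Type u} [CommRing R] [IsDomain R]

/-- The `w`-envelope `{x ∈ K | J x ⊆ N for some GV-ideal J}` of an `R`-submodule `N` of the
quotient field `K`. For `N ≠ 0` the field `K` is the injective envelope of `N`; for `N = 0`
both this set and the `w`-envelope are zero, because GV-ideals of a domain are nonzero. -/
def wEnvelope (N : Submodule R (FractionRing R)) : Set (FractionRing R) :=
  {x | ∃ J : Ideal R, IsGVIdeal J ∧ ∀ a ∈ J, a • x ∈ N}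

/-- An ideal `I` of `R` is a `w`-ideal if `I_w = I`. -/
def IsWIdeal (I : Ideal R) : Prop :=
  wEnvelope (Submodule.map (Algebra.linearMap R (FractionRing R)) I) =
    (Submodule.map (Algebra.linearMap R (FractionRing R)) I : Set (FractionRing R))

/-- Maximal elements of the set of proper `w`-ideals. -/
def IsMaximalWIdeal (m : Ideal R) : Prop :=
  Maximal (fun I : Ideal R => IsWIdeal I ∧ I ≠ ⊤) m

variable (R) in
/-- The set `w-Max(R)` of maximal `w`-ideals. -/
def WMax : Type u := {m : Ideal R // IsMaximalWIdeal m}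

theorem IsGVIdeal.ne_bot {J : Ideal R} (hJ : IsGVIdeal J) : J ≠ ⊥ := by
  rintro rfl
  refine one_ne_zero (hJ.2.1 (LinearMap.ext fun x => ?_) : (1 : R) = 0)
  simp [Subsingleton.elim x 0]

/-- `R` is a `w`-module: if `J x ⊆ R` for some GV-ideal `J`, then `x ∈ R`. -/
theorem IsGVIdeal.mem_range {J : Ideal R} (hJ : IsGVIdeal J) {x : FractionRing R}
    (h : ∀ a ∈ J, ∃ b : R, algebraMap R (FractionRing R) b = a • x) :
    ∃ b : R, algebraMap R (FractionRing R) b = x := by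
  have inj : Function.Injective (Algebra.linearMap R (FractionRing R)) :=
    IsFractionRing.injective R (FractionRing R)
  let f : J →ₗ[R] LinearMap.range (Algebra.linearMap R (FractionRing R)) :=
    ((LinearMap.toSpanSingleton R (FractionRing R) x).comp (Submodule.subtype J)).codRestrict _
      fun a => h a a.2
  obtain ⟨r, hr⟩ := hJ.2.2 ((LinearEquiv.ofInjective _ inj).symm.toLinearMap ∘ₗ f)
  obtain ⟨j, hj, hj0⟩ := Submodule.exists_mem_ne_zero_of_ne_bot hJ.ne_bot
  refine ⟨r, ?_⟩
  have h1 := congrArg (LinearEquiv.ofInjective _ inj) (LinearMap.congr_fun hr ⟨j, hj⟩)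
  have h2 := congrArg Subtype.val h1
  simp [f] at h2
  have hj1 : algebraMap R (FractionRing R) j ≠ 0 := fun h0 => hj0 (inj (by simpa using h0))
  rw [mul_comm] at h2
  exact mul_left_cancel₀ hj1 (h2.trans (Algebra.smul_def j x))

/-- Being a `w`-ideal can be tested on elements of `R`. -/
theorem isWIdeal_iff {I : Ideal R} :
    IsWIdeal I ↔ ∀ x : R, (∃ J : Ideal R, IsGVIdeal J ∧ ∀ a ∈ J, a * x ∈ I) → x ∈ I := by
  have inj : Function.Injective (algebraMap R (FractionRing R)) :=
    IsFractionRing.injective R (FractionRing R)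
  constructor
  · rintro h x ⟨J, hJ, hx⟩
    have : algebraMap R (FractionRing R) x ∈
        wEnvelope (Submodule.map (Algebra.linearMap R (FractionRing R)) I) :=
      ⟨J, hJ, fun a ha => ⟨a * x, hx a ha, by simp [Algebra.smul_def]⟩⟩
    rw [h] at this
    obtain ⟨y, hy, hyx⟩ := this
    exact inj hyx ▸ hy
  · intro h
    refine Set.Subset.antisymm ?_ ?_
    · rintro x ⟨J, hJ, hx⟩
      obtain ⟨b, rfl⟩ := hJ.mem_range fun a ha => by
        obtain ⟨b, -, hb⟩ := hx a ha
        exact ⟨b, hb⟩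
      refine ⟨b, h b ⟨J, hJ, fun a ha => ?_⟩, rfl⟩
      obtain ⟨c, hc, hcb⟩ := hx a ha
      have : c = a * b := inj (by simpa [Algebra.smul_def] using hcb)
      exact this ▸ hc
    · rintro _ ⟨b, hb, rfl⟩
      have htop : IsGVIdeal (⊤ : Ideal R) := by
        refine ⟨⟨{1}, by simp⟩, fun r s hrs => ?_, fun φ => ⟨φ ⟨1, trivial⟩, ?_⟩⟩
        · simpa using LinearMap.congr_fun hrs ⟨1, trivial⟩
        · ext ⟨y, hy⟩
          have h1 : (⟨y, hy⟩ : (⊤ : Ideal R)) = y • ⟨1, trivial⟩ := by ext; simp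
          rw [h1, map_smul]
          simp [mul_comm]
      exact ⟨⊤, htop, fun a _ => Submodule.smul_mem _ a ⟨b, hb, rfl⟩⟩

/-- Maximal `w`-ideals are prime. -/
theorem IsMaximalWIdeal.isPrime {m : Ideal R} (hm : IsMaximalWIdeal m) : m.IsPrime := by
  refine ⟨hm.prop.2, fun {a b} hab => or_iff_not_imp_left.2 fun ha => ?_⟩
  have hw := isWIdeal_iff.1 hm.prop.1
  let I : Ideal R := Submodule.comap (LinearMap.mulLeft R a) m
  have hI : IsWIdeal I ∧ I ≠ ⊤ := by
    refine ⟨isWIdeal_iff.2 ?_, fun h => ha ?_⟩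
    · rintro x ⟨J, hJ, hx⟩
      refine hw (a * x) ⟨J, hJ, fun c hc => ?_⟩
      have : a * (c * x) ∈ m := hx c hc
      rwa [mul_left_comm] at this
    · have : (1 : R) ∈ I := h ▸ trivial
      simpa [I] using this
  exact hm.le_of_ge hI (fun x hx => m.mul_mem_left a hx) hab

instance WMax.isPrime (m : WMax R) : m.1.IsPrime := m.2.isPrime

end WIdeals

/-! ### `w`-exactness, `w`-flatness and the `w`-weak global dimension -/

section WExact

variable (R : Type u) [CommRing R] [IsDomain R]

/-- `A → B → C` is `w`-exact at `B` if it becomes exact at `B` after localizing at every maximal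
`w`-ideal. -/
def WExact {A : Type v} {B : Type v} {C : Type v} [AddCommGroup A] [AddCommGroup B]
    [AddCommGroup C] [Module R A] [Module R B] [Module R C]
    (f : A →ₗ[R] B) (g : B →ₗ[R] C) : Prop :=
  ∀ m : WMax R, Function.Exact (LocalizedModule.map m.1.primeCompl f)
    (LocalizedModule.map m.1.primeCompl g)

/-- `M` is `w`-flat if `Tor₁(N, M)` is GV-torsion for every module `N`. -/
def WFlat (M : ModuleCat.{u} R) : Prop :=
  ∀ N : ModuleCat.{u} R, IsGVTorsion R (((Tor (ModuleCat.{u} R) 1).obj N).obj M)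

/-- A `w`-flat `w`-resolution of length `n` of `M`: a `w`-exact sequence
`0 → F n → ⋯ → F 1 → F 0 → M → 0` with all `F i` `w`-flat. It is indexed by all of `ℕ`, with
`F i = 0` for `i > n`; then `w`-exactness at `F n` says that `0 → F n → F (n - 1)` is `w`-exact. -/
structure WFlatResolution (M : ModuleCat.{u} R) (n : ℕ) where
  /-- the terms -/
  F : ℕ → ModuleCat.{u} R
  /-- the maps between the terms -/
  d : ∀ i, F (i + 1) →ₗ[R] F i
  /-- the augmentation -/
  ε : F 0 →ₗ[R] M
  wFlat : ∀ i, WFlat R (F i)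
  subsingleton : ∀ i, n < i → Subsingleton (F i)
  wExact_succ : ∀ i, WExact R (d (i + 1)) (d i)
  wExact_zero : WExact R (d 0) ε
  wExact_aug : WExact R ε (0 : M →ₗ[R] PUnit.{u + 1})

/-- The `w`-flat dimension of `M`: the length of a shortest `w`-flat `w`-resolution of `M`, and
`∞` if there is none. -/
def wFlatDim (M : ModuleCat.{u} R) : ℕ∞ :=
  ⨅ (n : ℕ) (_ : Nonempty (WFlatResolution R M n)), (n : ℕ∞)

/-- The `w`-weak global dimension of `R`: the supremum of the `w`-flat dimensions of all
`R`-modules. -/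
def wWeakGlobalDim : ℕ∞ :=
  ⨆ M : ModuleCat.{u} R, wFlatDim R M

end WExact

/-! ### Prüfer `v`-multiplication domains -/

section PvMD

variable {R : Type u} [CommRing R] [IsDomain R]

/-- The `t`-closure `X_t` of a fractional ideal `X`: the union of the sets
`F_v = (F⁻¹)⁻¹`, where `F` runs over the finitely generated fractional ideals contained in `X`
and `F⁻¹ = {x ∈ K | x F ⊆ R}` (with the convention `0⁻¹ = 0`, hence `0_v = 0`). -/
def tClosure (X : FractionalIdeal R⁰ (FractionRing R)) : Set (FractionRing R) :=
  {x | ∃ F : FractionalIdeal R⁰ (FractionRing R),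
    (F : Submodule R (FractionRing R)).FG ∧ F ≤ X ∧ x ∈ (F⁻¹)⁻¹}

/-- A fractional ideal `X` is `t`-invertible if `(X X⁻¹)_t = R`. -/
def IsTInvertible (X : FractionalIdeal R⁰ (FractionRing R)) : Prop :=
  tClosure (X * X⁻¹) = Set.range (algebraMap R (FractionRing R))

variable (R) in
/-- A domain is a Prüfer `v`-multiplication domain if each of its nonzero finitely generated
ideals is `t`-invertible. -/
def IsPvMD : Prop :=
  ∀ I : Ideal R, I.FG → I ≠ ⊥ → IsTInvertible (I : FractionalIdeal R⁰ (FractionRing R))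

end PvMD

/-! ### The Davis map -/

section Davis

variable {R : Type u} [CommRing R] {K : Type v} [Field K] [Algebra R K]
  {T : Type v} {S : Type v} [Ring T] [Ring S] [Algebra K T] [Algebra K S]
  [Algebra R T] [Algebra R S] [IsScalarTower R K T] [IsScalarTower R K S]

variable (K) in
/-- The canonical map `A ⊗_R B → T ⊗_K S`, `a ⊗ b ↦ a ⊗ b`, for `R`-subalgebras `A` of `T` and
`B` of `S`, where `T` and `S` are `K`-algebras. -/
def davisMap (A : Subalgebra R T) (B : Subalgebra R S) : A ⊗[R] B →ₗ[R] T ⊗[K] S :=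
  TensorProduct.mapOfCompatibleSMul K R R T S ∘ₗ
    TensorProduct.map A.val.toLinearMap B.val.toLinearMap

theorem davisMap_tmul (A : Subalgebra R T) (B : Subalgebra R S) (a : A) (b : B) :
    davisMap K A B (a ⊗ₜ[R] b) = (a : T) ⊗ₜ[K] (b : S) := rfl

end Davis

end WModule

end

/-!
All six conditions are local at the maximal `w`-ideals `m`. An ideal that lies in no such `m`
contains a GV-ideal (`exists_isGVIdeal_le`, by Zorn's lemma, GV-ideals being finitely generated), so
that a module is GV-torsion if and only if it vanishes at every `m` (`isGVTorsion_iff`). In the same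
way a nonzero finitely generated ideal `I` is `t`-invertible if and only if `I I⁻¹` lies in no `m`,
that is, `I` is principal at every `m`; hence `R` is a PvMD if and only if every `R_m` is a
valuation ring (`isPvMD_iff`).

This in turn is a statement about flatness. Torsion-free modules over a valuation ring are flat, so
over a PvMD every torsion-free module is flat at every `m`
(`flat_localizedModule_of_isTorsionFree`). Conversely, if the ideals of `R` are flat at `m`, then
`R_m` is a valuation ring (`valuationRing_localization_of_flat`): for `I = (a, b)` the element `a ⊗
b - b ⊗ a` of `I ⊗ I` vanishes at `m`, and by the equational criterion for vanishing one of `a`, `b`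
divides the other at `m`. Each of the other conditions follows from the flatness of torsion-free
modules, and implies either the flatness of ideals or this vanishing.

* For `Tor`: if `P` is a projective resolution of `N`, all modules `Tor (n + 1) X N` are GV-torsion
  if and only if the cokernel of `P (n + 1) → P n` is flat at every `m`
  (`forall_isGVTorsion_tor_succ_iff`). For `n = 0` this cokernel is `N`, so `w`-flat means flat at
  every `m`; for `n = 1` it is the first syzygy of `N`, a torsion-free module.
* If `R ⧸ I` has locally a flat resolution of length one, then `I` is locally flat, by Schanuel's
  lemma for flat modules (`flat_ker_of_flat_resolution`). This covers both `Tor₂` and the `w`-weak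
  global dimension.
* The Davis map of `A` and `B` is injective at `m` when `B` is flat there. For the converse, take `A
  = B = R + I ε` inside the dual numbers `K[ε]`: the kernel contains `aε ⊗ bε - bε ⊗ aε`, and `I ⊗
  I` is a direct summand of `A ⊗ A`.
-/

namespace WModule

/-! ### GV-ideals and maximal `w`-ideals -/

section Saturation

variable {R : Type u} [CommRing R] [IsDomain R]

/-- A nonzero finitely generated ideal `J` is a GV-ideal if and only if `J⁻¹ = R`, because every
linear map `J → R` is the multiplication by an element of the quotient field. -/
theorem isGVIdeal_iff {J : Ideal R} : IsGVIdeal J ↔ J.FG ∧ J ≠ ⊥ ∧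
    ∀ x : FractionRing R, (∀ a ∈ J, ∃ b : R, algebraMap R (FractionRing R) b = a • x) →
      ∃ b : R, algebraMap R (FractionRing R) b = x := by
  refine ⟨fun h => ⟨h.1, h.ne_bot, fun x hx => h.mem_range hx⟩, fun ⟨hfg, h0, h⟩ => ⟨hfg, ?_, ?_⟩⟩
  · intro r s hrs
    obtain ⟨j, hj, hj0⟩ := Submodule.exists_mem_ne_zero_of_ne_bot h0
    exact mul_right_cancel₀ hj0 (by simpa using LinearMap.congr_fun hrs ⟨j, hj⟩)
  · intro φ
    obtain ⟨j, hj, hj0⟩ := Submodule.exists_mem_ne_zero_of_ne_bot h0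
    have inj : Function.Injective (algebraMap R (FractionRing R)) :=
      IsFractionRing.injective R (FractionRing R)
    have hj1 : algebraMap R (FractionRing R) j ≠ 0 := fun h => hj0 (inj (by simpa using h))
    -- the two ways of computing `φ (j * a)`
    have key : ∀ a : J, j * φ a = a * φ ⟨j, hj⟩ := fun a => by
      rw [← smul_eq_mul, ← smul_eq_mul, ← map_smul, ← map_smul]
      congr 1
      ext
      simp [mul_comm]
    have key' : ∀ a : J, (a : R) • (algebraMap R (FractionRing R) (φ ⟨j, hj⟩) /
        algebraMap R (FractionRing R) j) = algebraMap R (FractionRing R) (φ a) := fun a => by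
      rw [Algebra.smul_def, mul_div_assoc', ← map_mul, ← key, map_mul, mul_div_cancel_left₀ _ hj1]
    obtain ⟨r, hr⟩ := h _ fun a ha => ⟨φ ⟨a, ha⟩, (key' ⟨a, ha⟩).symm⟩
    refine ⟨r, LinearMap.ext fun a => inj ?_⟩
    rw [← key' a, ← hr, Algebra.smul_def, ← map_mul]
    simp [mul_comm]

theorem isGVIdeal_top : IsGVIdeal (⊤ : Ideal R) :=
  isGVIdeal_iff.2 ⟨⟨{1}, by simp⟩, top_ne_bot, fun x hx => by simpa using hx 1 trivial⟩

theorem IsGVIdeal.mul {I J : Ideal R} (hI : IsGVIdeal I) (hJ : IsGVIdeal J) :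
    IsGVIdeal (I * J) := by
  refine isGVIdeal_iff.2 ⟨hI.1.mul hJ.1, mul_ne_zero hI.ne_bot hJ.ne_bot, fun x hx => ?_⟩
  refine hI.mem_range fun a ha => hJ.mem_range fun b hb => ?_
  obtain ⟨c, hc⟩ := hx _ (Ideal.mul_mem_mul ha hb)
  exact ⟨c, by rw [hc, smul_smul, mul_comm]⟩

/-- The `w`-closure of an ideal `I`, as an ideal: the elements that some GV-ideal multiplies
into `I`. By `IsGVIdeal.mem_range` it is the trace on `R` of `wEnvelope`, hence all of it. -/
def wClosure (I : Ideal R) : Ideal R where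
  carrier := {x | ∃ J : Ideal R, IsGVIdeal J ∧ ∀ a ∈ J, a * x ∈ I}
  add_mem' := by
    rintro x y ⟨J, hJ, hx⟩ ⟨L, hL, hy⟩
    refine ⟨J * L, hJ.mul hL, fun a ha => ?_⟩
    rw [mul_add]
    exact I.add_mem (hx a ((Ideal.mul_le_left : J * L ≤ J) ha))
      (hy a ((Ideal.mul_le_right : J * L ≤ L) ha))
  zero_mem' := ⟨⊤, isGVIdeal_top, by simp⟩
  smul_mem' := by
    rintro r x ⟨J, hJ, hx⟩
    refine ⟨J, hJ, fun a ha => ?_⟩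
    rw [smul_eq_mul, mul_left_comm]
    exact I.mul_mem_left r (hx a ha)

theorem mem_wClosure {I : Ideal R} {x : R} :
    x ∈ wClosure I ↔ ∃ J : Ideal R, IsGVIdeal J ∧ ∀ a ∈ J, a * x ∈ I := Iff.rfl

theorem le_wClosure (I : Ideal R) : I ≤ wClosure I :=
  fun _ hx => ⟨⊤, isGVIdeal_top, fun a _ => I.mul_mem_left a hx⟩

/-- One GV-ideal works for all elements of a finitely generated ideal inside the `w`-closure. -/
theorem exists_isGVIdeal_mul_le {I L : Ideal R} (hL : L.FG) (h : L ≤ wClosure I) :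
    ∃ J : Ideal R, IsGVIdeal J ∧ J * L ≤ I := by
  classical
  obtain ⟨s, rfl⟩ := hL
  induction s using Finset.induction_on with
  | empty => exact ⟨⊤, isGVIdeal_top, by simp⟩
  | insert a s _ ih =>
    rw [Finset.coe_insert, Ideal.span_insert] at h ⊢
    obtain ⟨J, hJ, hJs⟩ := ih (le_sup_right.trans h)
    obtain ⟨J', hJ', ha⟩ := mem_wClosure.1
      (h (Submodule.mem_sup_left (Submodule.mem_span_singleton_self a)))
    refine ⟨J' * J, hJ'.mul hJ, ?_⟩
    rw [Ideal.mul_sup]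
    refine sup_le ?_ ((Ideal.mul_mono_left Ideal.mul_le_right).trans hJs)
    rw [mul_comm]
    refine Ideal.span_singleton_mul_le_iff.2 fun x hx => ?_
    rw [mul_comm]
    exact ha x ((Ideal.mul_le_left : J' * J ≤ J') hx)

theorem isWIdeal_wClosure (I : Ideal R) : IsWIdeal (wClosure I) := by
  refine isWIdeal_iff.2 fun x ⟨J, hJ, hx⟩ => ?_
  obtain ⟨L, hL, h⟩ := exists_isGVIdeal_mul_le (L := Ideal.span {x} * J)
    ((Submodule.fg_span_singleton x).mul hJ.1)
    (Ideal.span_singleton_mul_le_iff.2 fun a ha => by simpa [mul_comm] using hx a ha)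
  refine ⟨L * J, hL.mul hJ, fun a ha => h ?_⟩
  rw [mul_comm (Ideal.span {x}), ← mul_assoc]
  exact Ideal.mul_mem_mul ha (Ideal.mem_span_singleton_self x)

/-- A GV-ideal lies in no maximal `w`-ideal. -/
theorem IsGVIdeal.not_le {J : Ideal R} (hJ : IsGVIdeal J) (m : WMax R) : ¬ J ≤ m.1 := fun h =>
  m.2.prop.2 ((Ideal.eq_top_iff_one _).2
    (isWIdeal_iff.1 m.2.prop.1 1 ⟨J, hJ, fun a ha => by simpa using h ha⟩))

/-- A proper `w`-ideal lies in a maximal one: as GV-ideals are finitely generated, the union of a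
chain of `w`-ideals is a `w`-ideal. -/
theorem exists_wMax_ge {I : Ideal R} (hI : IsWIdeal I) (hI' : I ≠ ⊤) : ∃ m : WMax R, I ≤ m.1 := by
  have hchain : ∀ c ⊆ {I : Ideal R | IsWIdeal I ∧ I ≠ ⊤}, IsChain (· ≤ ·) c → ∀ L ∈ c,
      ∃ N ∈ {I : Ideal R | IsWIdeal I ∧ I ≠ ⊤}, ∀ M ∈ c, M ≤ N := by
    intro c hc hchain L hL
    have hdir := hchain.directedOn
    have hne : c.Nonempty := ⟨L, hL⟩
    refine ⟨sSup c, ⟨isWIdeal_iff.2 fun x ⟨J, hJ, hx⟩ => ?_, fun h => ?_⟩, fun _ => le_sSup⟩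
    · have hfg : (Ideal.span {x} * J).FG := (Submodule.fg_span_singleton x).mul hJ.1
      have hle : Ideal.span {x} * J ≤ sSup c :=
        Ideal.span_singleton_mul_le_iff.2 fun a ha => by simpa [mul_comm] using hx a ha
      obtain ⟨N, hN, hJN⟩ := (CompleteLattice.isCompactElement_iff_le_of_directed_sSup_le _ _).1
        ((Submodule.fg_iff_compact _).1 hfg) c hne hdir hle
      refine (le_sSup hN : N ≤ sSup c) (isWIdeal_iff.1 (hc hN).1 x ⟨J, hJ, fun a ha => ?_⟩)
      rw [mul_comm]
      exact Ideal.span_singleton_mul_le_iff.1 hJN a ha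
    · obtain ⟨N, hN, h1⟩ := (Submodule.mem_sSup_of_directed hne hdir).1
        ((Ideal.eq_top_iff_one _).1 h)
      exact (hc hN).2 ((Ideal.eq_top_iff_one _).2 h1)
  obtain ⟨m, hm, hmax⟩ := zorn_le_nonempty₀ _ hchain I ⟨hI, hI'⟩
  exact ⟨⟨m, hmax⟩, hm⟩

/-- An ideal that lies in no maximal `w`-ideal contains a GV-ideal. -/
theorem exists_isGVIdeal_le {I : Ideal R} (h : ∀ m : WMax R, ¬ I ≤ m.1) :
    ∃ J : Ideal R, IsGVIdeal J ∧ J ≤ I := by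
  by_contra hJ
  obtain ⟨m, hm⟩ := exists_wMax_ge (isWIdeal_wClosure I) fun htop => hJ <| by
    obtain ⟨J, hJ, h1⟩ := mem_wClosure.1 ((Ideal.eq_top_iff_one _).1 htop)
    exact ⟨J, hJ, fun a ha => by simpa using h1 a ha⟩
  exact h m ((le_wClosure I).trans hm)

/-- A module is GV-torsion if and only if it vanishes at every maximal `w`-ideal. -/
theorem isGVTorsion_iff {M : Type v} [AddCommGroup M] [Module R M] :
    IsGVTorsion R M ↔ ∀ (m : WMax R) (x : M), ∃ s ∈ m.1.primeCompl, s • x = 0 := by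
  refine ⟨fun h m x => ?_, fun h x => ?_⟩
  · obtain ⟨J, hJ, hx⟩ := h x
    obtain ⟨s, hs, hsm⟩ := Set.not_subset.1 (hJ.not_le m)
    exact ⟨s, hsm, hx s hs⟩
  · obtain ⟨J, hJ, hle⟩ := exists_isGVIdeal_le (I := Ideal.torsionOf R M x) fun m hm => by
      obtain ⟨s, hs, hsx⟩ := h m x
      exact hs (hm hsx)
    exact ⟨J, hJ, fun a ha => hle ha⟩

end Saturation

/-! ### PvMDs and their localizations at the maximal `w`-ideals -/

section PvMD

variable {R : Type u} [CommRing R] [IsDomain R]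

/-- Divisibility in the local ring at `p`, with denominators cleared: of any two elements of `R`,
one divides the other at `p`. -/
theorem valuationRing_localization_iff {p : Ideal R} [p.IsPrime] :
    ValuationRing (Localization.AtPrime p) ↔
      ∀ a b : R, ∃ s ∈ p.primeCompl, ∃ c, s * a = c * b ∨ s * b = c * a := by
  have hle := p.primeCompl_le_nonZeroDivisors
  have : IsDomain (Localization.AtPrime p) := IsLocalization.isDomain_localization hle
  have inj := IsLocalization.injective (Localization.AtPrime p) hle
  have key : ∀ a b : R, algebraMap R (Localization.AtPrime p) b ∣ algebraMap R _ a ↔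
      ∃ s ∈ p.primeCompl, ∃ c, s * a = c * b := fun a b => by
    constructor
    · rintro ⟨z, hz⟩
      obtain ⟨⟨c, s⟩, hc⟩ := IsLocalization.surj p.primeCompl z
      refine ⟨s, s.2, c, inj ?_⟩
      simp only [map_mul, hz, ← hc]
      ring
    · rintro ⟨s, hs, c, h⟩
      have hu := IsLocalization.map_units (Localization.AtPrime p) (⟨s, hs⟩ : p.primeCompl)
      rw [← hu.dvd_mul_left, ← map_mul]
      simp only [h, map_mul]
      exact dvd_mul_left _ _
  rw [ValuationRing.iff_dvd_total]
  constructor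
  · rintro ⟨h⟩ a b
    rcases h (algebraMap R _ b) (algebraMap R _ a) with h | h
    · obtain ⟨s, hs, c, h⟩ := (key a b).1 h
      exact ⟨s, hs, c, .inl h⟩
    · obtain ⟨s, hs, c, h⟩ := (key b a).1 h
      exact ⟨s, hs, c, .inr h⟩
  · refine fun h => ⟨fun x y => ?_⟩
    obtain ⟨⟨a, s⟩, ha⟩ := IsLocalization.surj p.primeCompl x
    obtain ⟨⟨b, t⟩, hb⟩ := IsLocalization.surj p.primeCompl y
    have hs := IsLocalization.map_units (Localization.AtPrime p) s
    have ht := IsLocalization.map_units (Localization.AtPrime p) t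
    have hxy : (x ∣ y ↔ algebraMap R (Localization.AtPrime p) a ∣ algebraMap R _ b) ∧
        (y ∣ x ↔ algebraMap R (Localization.AtPrime p) b ∣ algebraMap R _ a) := by
      simp only at ha hb
      rw [← ha, ← hb, hs.mul_right_dvd, ht.dvd_mul_right, ht.mul_right_dvd, hs.dvd_mul_right]
      exact ⟨Iff.rfl, Iff.rfl⟩
    rw [hxy.1, hxy.2, key, key]
    obtain ⟨u, hu, c, h | h⟩ := h a b
    · exact .inr ⟨u, hu, c, h⟩
    · exact .inl ⟨u, hu, c, h⟩

omit [IsDomain R] in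
theorem algebraMap_fractionRing_injective :
    Function.Injective (algebraMap R (FractionRing R)) :=
  IsFractionRing.injective R (FractionRing R)

theorem inv_le_one_of_one_mem_inv_inv {F : FractionalIdeal R⁰ (FractionRing R)}
    (h : (1 : FractionRing R) ∈ (F⁻¹)⁻¹) : F⁻¹ ≤ 1 := by
  intro x hx
  by_cases h0 : F⁻¹ = 0
  · simp [h0, FractionalIdeal.inv_zero'] at h
  · simpa using (FractionalIdeal.mem_inv_iff h0).1 h x hx

/-- If `X` is `t`-invertible, then `1 ∈ F_v` for some finitely generated `F ⊆ X X⁻¹ ⊆ R`, and such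
an `F` is a GV-ideal. -/
theorem IsTInvertible.exists_isGVIdeal {X : FractionalIdeal R⁰ (FractionRing R)}
    (h : IsTInvertible X) :
    ∃ J : Ideal R, IsGVIdeal J ∧ (J : FractionalIdeal R⁰ (FractionRing R)) ≤ X * X⁻¹ := by
  have h1 : (1 : FractionRing R) ∈ tClosure (X * X⁻¹) := by
    rw [h]
    exact ⟨1, map_one _⟩
  obtain ⟨F, hF, hle, h1⟩ := h1
  have hF0 : F ≠ 0 := by
    rintro rfl
    simp [FractionalIdeal.inv_zero'] at h1
  have hF1 : F ≤ 1 := hle.trans FractionalIdeal.mul_one_div_le_one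
  obtain ⟨J, rfl⟩ := FractionalIdeal.le_one_iff_exists_coeIdeal.1 hF1
  refine ⟨J, isGVIdeal_iff.2 ⟨?_, ?_, fun x hx => ?_⟩, hle⟩
  · exact (FractionalIdeal.coeIdeal_fg _ algebraMap_fractionRing_injective _).1 hF
  · rintro rfl
    simp at hF0
  · have := inv_le_one_of_one_mem_inv_inv h1 (x := x) ((FractionalIdeal.mem_inv_iff hF0).2 ?_)
    · simpa [FractionalIdeal.mem_one_iff] using this
    · intro y hy
      obtain ⟨a, ha, rfl⟩ := (FractionalIdeal.mem_coeIdeal _).1 hy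
      obtain ⟨b, hb⟩ := hx a ha
      exact (FractionalIdeal.mem_one_iff _).2 ⟨b, by rw [hb, Algebra.smul_def, mul_comm]⟩

theorem isTInvertible_of_isGVIdeal {X : FractionalIdeal R⁰ (FractionRing R)} {J : Ideal R}
    (hJ : IsGVIdeal J) (h : (J : FractionalIdeal R⁰ (FractionRing R)) ≤ X * X⁻¹) :
    IsTInvertible X := by
  refine Set.Subset.antisymm ?_ ?_
  · rintro x ⟨F, -, hle, hx⟩
    by_cases h0 : F⁻¹ = 0
    · have hx0 : x ∈ (F⁻¹)⁻¹ := hx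
      rw [h0, FractionalIdeal.inv_zero', FractionalIdeal.mem_zero_iff] at hx0
      exact ⟨0, by simp [hx0]⟩
    have hF0 : F ≠ 0 := by
      rintro rfl
      exact h0 (FractionalIdeal.inv_zero' _)
    have hF1 : F ≤ 1 := hle.trans FractionalIdeal.mul_one_div_le_one
    have := (FractionalIdeal.mem_inv_iff h0).1 hx 1
      ((FractionalIdeal.mem_inv_iff hF0).2 fun y hy => by simpa using hF1 hy)
    simpa [FractionalIdeal.mem_one_iff] using this
  · rintro _ ⟨r, rfl⟩
    have hJ0 : (J : FractionalIdeal R⁰ (FractionRing R)) ≠ 0 := by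
      simpa using hJ.ne_bot
    refine ⟨J, (FractionalIdeal.coeIdeal_fg _ algebraMap_fractionRing_injective _).2 hJ.1, h, ?_⟩
    have hinv : (J : FractionalIdeal R⁰ (FractionRing R))⁻¹ = 1 := by
      refine le_antisymm (fun x hx => ?_) (fun x hx => ?_)
      · obtain ⟨b, rfl⟩ := hJ.mem_range (x := x) fun a ha => by
          obtain ⟨b, hb⟩ := (FractionalIdeal.mem_one_iff _).1
            ((FractionalIdeal.mem_inv_iff hJ0).1 hx _ (FractionalIdeal.mem_coeIdeal_of_mem _ ha))
          exact ⟨b, by rw [hb, Algebra.smul_def, mul_comm]⟩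
        exact (FractionalIdeal.mem_one_iff _).2 ⟨b, rfl⟩
      · obtain ⟨b, rfl⟩ := (FractionalIdeal.mem_one_iff _).1 hx
        refine (FractionalIdeal.mem_inv_iff hJ0).2 fun y hy => ?_
        obtain ⟨a, ha, rfl⟩ := (FractionalIdeal.mem_coeIdeal _).1 hy
        exact (FractionalIdeal.mem_one_iff _).2 ⟨b * a, map_mul _ _ _⟩
    rw [hinv, inv_one]
    exact (FractionalIdeal.mem_one_iff _).2 ⟨r, rfl⟩

/-- An ideal `I` is `t`-invertible if and only if it is principal at every maximal `w`-ideal `m`: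
`I I⁻¹` is not contained in `m` exactly when `s = x y` for some `s ∉ m`, `x ∈ I` and `y ∈ I⁻¹`, and
then `s I ⊆ x R`. -/
theorem isTInvertible_coeIdeal_iff {I : Ideal R} (hI : I ≠ ⊥) :
    IsTInvertible (I : FractionalIdeal R⁰ (FractionRing R)) ↔
      ∀ m : WMax R, ∃ x ∈ I, ∃ s ∈ m.1.primeCompl, ∀ a ∈ I, ∃ c, s * a = c * x := by
  have inj := algebraMap_fractionRing_injective (R := R)
  have hI0 : (I : FractionalIdeal R⁰ (FractionRing R)) ≠ 0 := by simpa using hI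
  constructor
  · intro h m
    obtain ⟨J, hJ, hle⟩ := h.exists_isGVIdeal
    by_contra! hcon
    refine hJ.not_le m fun j hj => ?_
    suffices H : ∀ z ∈ (I : FractionalIdeal R⁰ (FractionRing R)) *
        (I : FractionalIdeal R⁰ (FractionRing R))⁻¹,
          ∃ b ∈ m.1, algebraMap R (FractionRing R) b = z by
      obtain ⟨b, hb, hbj⟩ := H _ (hle (FractionalIdeal.mem_coeIdeal_of_mem _ hj))
      exact inj hbj ▸ hb
    intro z hz
    refine FractionalIdeal.mul_induction_on hz (fun i hi y hy => ?_) ?_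
    · obtain ⟨x, hx, rfl⟩ := (FractionalIdeal.mem_coeIdeal _).1 hi
      have hy' : ∀ a ∈ I, ∃ b, algebraMap R (FractionRing R) b = y * algebraMap R _ a := fun a ha =>
        (FractionalIdeal.mem_one_iff _).1 ((FractionalIdeal.mem_inv_iff hI0).1 hy _
          (FractionalIdeal.mem_coeIdeal_of_mem _ ha))
      obtain ⟨s, hs⟩ := hy' x hx
      refine ⟨s, ?_, by rw [hs, mul_comm]⟩
      by_contra hsm
      obtain ⟨a, ha, hne⟩ := hcon x hx s hsm
      obtain ⟨c, hc⟩ := hy' a ha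
      refine hne c (inj ?_)
      rw [map_mul, map_mul, hs, hc]
      ring
    · rintro _ _ ⟨b, hb, rfl⟩ ⟨c, hc, rfl⟩
      exact ⟨b + c, m.1.add_mem hb hc, map_add _ _ _⟩
  · intro h
    -- `I I⁻¹`, as an ideal of `R`
    let L : Ideal R := Submodule.comap (Algebra.linearMap R (FractionRing R))
      ((I : FractionalIdeal R⁰ (FractionRing R)) * (I : FractionalIdeal R⁰ (FractionRing R))⁻¹ :
        FractionalIdeal R⁰ (FractionRing R))
    obtain ⟨J, hJ, hle⟩ := exists_isGVIdeal_le (I := L) fun m hm => by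
      obtain ⟨x, hx, s, hs, hsx⟩ := h m
      refine hs (hm ?_)
      have hx0 : algebraMap R (FractionRing R) x ≠ 0 := fun h0 => by
        have hx0 : x = 0 := inj (by simpa using h0)
        obtain ⟨i, hi, hi0⟩ := Submodule.exists_mem_ne_zero_of_ne_bot hI
        obtain ⟨c, hc⟩ := hsx i hi
        rw [hx0, mul_zero] at hc
        rcases mul_eq_zero.1 hc with rfl | h
        · exact hs m.1.zero_mem
        · exact hi0 h
      change algebraMap R (FractionRing R) s ∈ (I : FractionalIdeal R⁰ (FractionRing R)) *
        (I : FractionalIdeal R⁰ (FractionRing R))⁻¹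
      rw [← mul_div_cancel₀ (algebraMap R (FractionRing R) s) hx0]
      refine FractionalIdeal.mul_mem_mul (FractionalIdeal.mem_coeIdeal_of_mem _ hx)
        ((FractionalIdeal.mem_inv_iff hI0).2 fun y hy => ?_)
      obtain ⟨a, ha, rfl⟩ := (FractionalIdeal.mem_coeIdeal _).1 hy
      obtain ⟨c, hc⟩ := hsx a ha
      refine (FractionalIdeal.mem_one_iff _).2 ⟨c, ?_⟩
      rw [div_mul_eq_mul_div, ← map_mul, hc, map_mul, mul_div_cancel_right₀ _ hx0]
    refine isTInvertible_of_isGVIdeal hJ fun y hy => ?_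
    obtain ⟨a, ha, rfl⟩ := (FractionalIdeal.mem_coeIdeal _).1 hy
    exact hle ha

/-- At a valuation ring, a finitely generated ideal becomes principal, generated by an element
of any finite generating set. -/
theorem exists_mul_eq_of_valuationRing_localization {p : Ideal R} [p.IsPrime]
    (hp : ValuationRing (Localization.AtPrime p)) {I : Ideal R} (hI : I.FG) :
    ∃ x ∈ I, ∃ s ∈ p.primeCompl, ∀ a ∈ I, ∃ c, s * a = c * x := by
  classical
  rw [valuationRing_localization_iff] at hp
  obtain ⟨t, rfl⟩ := hI
  induction t using Finset.induction_on with
  | empty => exact ⟨0, zero_mem _, 1, one_mem _, by simp⟩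
  | insert a t _ ih =>
    obtain ⟨x, hx, s, hs, hsx⟩ := ih
    rw [Finset.coe_insert, Ideal.span_insert]
    obtain ⟨u, hu, d, h | h⟩ := hp a x
    · refine ⟨x, Submodule.mem_sup_right hx, u * s, mul_mem hu hs, fun y hy => ?_⟩
      obtain ⟨_, hr, z, hz, rfl⟩ := Submodule.mem_sup.1 hy
      obtain ⟨r, rfl⟩ := Ideal.mem_span_singleton'.1 hr
      obtain ⟨c, hc⟩ := hsx z hz
      exact ⟨s * r * d + u * c, by linear_combination s * r * h + u * hc⟩
    · refine ⟨a, Submodule.mem_sup_left (Ideal.mem_span_singleton_self a), u * s, mul_mem hu hs,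
        fun y hy => ?_⟩
      obtain ⟨_, hr, z, hz, rfl⟩ := Submodule.mem_sup.1 hy
      obtain ⟨r, rfl⟩ := Ideal.mem_span_singleton'.1 hr
      obtain ⟨c, hc⟩ := hsx z hz
      exact ⟨u * s * r + c * d, by linear_combination u * hc + c * h⟩

/-- If the ideal `(a, b)` is principal at `p`, then one of `a`, `b` divides the other at `p`:
writing the generator `x` in terms of `a` and `b` shows that one of the quotients `a / x`, `b / x`
is a unit at `p`. -/
theorem exists_mul_eq_or_of_span_pair {p : Ideal R} [p.IsPrime] {a b x s : R}
    (hx : x ∈ Ideal.span {a, b}) (hx0 : x ≠ 0) (hs : s ∈ p.primeCompl) {c d : R}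
    (ha : s * a = c * x) (hb : s * b = d * x) :
    ∃ u ∈ p.primeCompl, ∃ e, u * a = e * b ∨ u * b = e * a := by
  obtain ⟨y, z, rfl⟩ := Ideal.mem_span_pair.1 hx
  have hsum : s = y * c + z * d :=
    mul_right_cancel₀ hx0 (by linear_combination y * ha + z * hb)
  have hcd : d * a = c * b := by
    have hs0 : s ≠ 0 := fun h => hs (h ▸ p.zero_mem)
    refine mul_left_cancel₀ hs0 ?_
    linear_combination d * ha - c * hb
  by_cases hd : d ∈ p
  · refine ⟨c, fun hc => hs ?_, d, .inr hcd.symm⟩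
    rw [hsum]
    exact add_mem (p.mul_mem_left _ hc) (p.mul_mem_left _ hd)
  · exact ⟨d, hd, c, .inl hcd⟩

/-- A domain is a PvMD if and only if its localizations at the maximal `w`-ideals are valuation
rings. -/
theorem isPvMD_iff : IsPvMD R ↔ ∀ m : WMax R, ValuationRing (Localization.AtPrime m.1) := by
  refine ⟨fun h m => valuationRing_localization_iff.2 fun a b => ?_, fun h I hI hI0 =>
    (isTInvertible_coeIdeal_iff hI0).2 fun m =>
      exists_mul_eq_of_valuationRing_localization (h m) hI⟩
  by_cases hab : Ideal.span {a, b} = ⊥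
  · have ha : a = 0 := by
      have : a ∈ Ideal.span {a, b} := Ideal.subset_span (by simp)
      rwa [hab] at this
    exact ⟨1, one_mem _, 0, .inl (by simp [ha])⟩
  obtain ⟨x, hx, s, hs, hsx⟩ := (isTInvertible_coeIdeal_iff hab).1
    (h _ (Submodule.fg_span (by simp)) hab) m
  obtain ⟨c, hc⟩ := hsx a (Ideal.subset_span (by simp))
  obtain ⟨d, hd⟩ := hsx b (Ideal.subset_span (by simp))
  have hx0 : x ≠ 0 := by
    rintro rfl
    have hs0 : s ≠ 0 := fun h => hs (h ▸ m.1.zero_mem)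
    refine hab (Ideal.span_eq_bot.2 ?_)
    simpa [hs0] using And.intro hc hd
  exact exists_mul_eq_or_of_span_pair hx hx0 hs hc hd

end PvMD

/-! ### Flat modules and short exact sequences -/

section Flat

variable {R : Type u} [CommRing R]

/-- A short exact sequence with flat cokernel stays exact after tensoring with any module. -/
theorem lTensor_injective_of_flat_cokernel {Z P A : Type u} [AddCommGroup Z] [AddCommGroup P]
    [AddCommGroup A] [Module R Z] [Module R P] [Module R A] {i : Z →ₗ[R] P} {q : P →ₗ[R] A}
    (hi : Function.Injective i) (hiq : Function.Exact i q) (hq : Function.Surjective q)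
    [Module.Flat R A] (X : Type u) [AddCommGroup X] [Module R X] :
    Function.Injective (i.lTensor X) := by
  let π : (X →₀ R) →ₗ[R] X := Finsupp.linearCombination R id
  refine lTensor_injective_of_exact_of_exact_of_rTensor_injective
    (M₁ := LinearMap.ker π) (M₂ := X →₀ R) (LinearMap.exact_subtype_ker_map π)
    (Finsupp.linearCombination_id_surjective R X) hiq hq ?_
    (Module.Flat.lTensor_preserves_injective_linearMap _ hi)
  exact Module.Flat.rTensor_preserves_injective_linearMap _ (LinearMap.ker π).injective_subtype

/-- If a short exact sequence with flat middle term stays exact after tensoring with any module,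
then its cokernel is flat. -/
theorem flat_of_lTensor_injective {Z P A : Type u} [AddCommGroup Z] [AddCommGroup P]
    [AddCommGroup A] [Module R Z] [Module R P] [Module R A] {i : Z →ₗ[R] P} {q : P →ₗ[R] A}
    (hiq : Function.Exact i q) (hq : Function.Surjective q) [Module.Flat R P]
    (h : ∀ (X : Type u) [AddCommGroup X] [Module R X], Function.Injective (i.lTensor X)) :
    Module.Flat R A := by
  refine Module.Flat.iff_lTensor_preserves_injective_linearMap.2 fun N N' _ _ _ _ f hf => ?_
  exact lTensor_injective_of_exact_of_exact_of_rTensor_injective hiq hq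
    (LinearMap.exact_map_mkQ_range f) (Submodule.mkQ_surjective _)
    ((LinearMap.lTensor_inj_iff_rTensor_inj _ _).1 (h _))
    (Module.Flat.lTensor_preserves_injective_linearMap _ hf)

/-- An extension of flat modules is flat. -/
theorem flat_of_exact_of_flat {A B C : Type u} [AddCommGroup A] [AddCommGroup B] [AddCommGroup C]
    [Module R A] [Module R B] [Module R C] {f : A →ₗ[R] B} {g : B →ₗ[R] C}
    (hf : Function.Injective f) (hfg : Function.Exact f g) (hg : Function.Surjective g)
    [Module.Flat R A] [Module.Flat R C] : Module.Flat R B := by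
  refine Module.Flat.iff_rTensor_preserves_injective_linearMap.2 fun N N' _ _ _ _ j hj => ?_
  rw [injective_iff_map_eq_zero]
  intro x hx
  have hx' : g.lTensor N x = 0 := by
    refine Module.Flat.rTensor_preserves_injective_linearMap (M := C) j hj ?_
    rw [map_zero, ← LinearMap.comp_apply, LinearMap.rTensor_comp_lTensor,
      ← LinearMap.lTensor_comp_rTensor, LinearMap.comp_apply, hx, map_zero]
  obtain ⟨y, rfl⟩ := (lTensor_exact N hfg hg x).1 hx'
  have hy : y = 0 := by
    refine Module.Flat.rTensor_preserves_injective_linearMap (M := A) j hj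
      (lTensor_injective_of_flat_cokernel hf hfg hg N' ?_)
    rw [map_zero, map_zero, ← LinearMap.comp_apply, LinearMap.lTensor_comp_rTensor,
      ← LinearMap.rTensor_comp_lTensor, LinearMap.comp_apply, hx]
  rw [hy, map_zero]

/-- The kernel of a surjection of flat modules is flat. -/
theorem flat_ker_of_flat {A B C : Type u} [AddCommGroup A] [AddCommGroup B] [AddCommGroup C]
    [Module R A] [Module R B] [Module R C] {f : A →ₗ[R] B} {g : B →ₗ[R] C}
    (hf : Function.Injective f) (hfg : Function.Exact f g) (hg : Function.Surjective g)
    [Module.Flat R B] [Module.Flat R C] : Module.Flat R A := by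
  refine Module.Flat.iff_rTensor_preserves_injective_linearMap.2 fun N N' _ _ _ _ j hj => ?_
  refine Function.Injective.of_comp (f := f.lTensor N') ?_
  rw [← LinearMap.coe_comp, LinearMap.lTensor_comp_rTensor, ← LinearMap.rTensor_comp_lTensor,
    LinearMap.coe_comp]
  exact (Module.Flat.rTensor_preserves_injective_linearMap j hj).comp
    (lTensor_injective_of_flat_cokernel hf hfg hg N)

/-- Schanuel's lemma for flat modules: if `M` has a flat resolution of length one, then the kernel
of any surjection from a flat module onto `M` is flat. -/
theorem flat_ker_of_flat_resolution {F₁ F₀ Z P M : Type u} [AddCommGroup F₁] [AddCommGroup F₀]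
    [AddCommGroup Z] [AddCommGroup P] [AddCommGroup M] [Module R F₁] [Module R F₀] [Module R Z]
    [Module R P] [Module R M] [Module.Flat R F₁] [Module.Flat R F₀] [Module.Flat R P]
    {d : F₁ →ₗ[R] F₀} {ε : F₀ →ₗ[R] M} {i : Z →ₗ[R] P} {q : P →ₗ[R] M}
    (hd : Function.Injective d) (hdε : Function.Exact d ε) (hε : Function.Surjective ε)
    (hi : Function.Injective i) (hiq : Function.Exact i q) (hq : Function.Surjective q) :
    Module.Flat R Z := by
  -- the pullback `E` of `ε` and `q` is an extension of `P` by `F₁` and of `F₀` by `Z`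
  let E : Submodule R (F₀ × P) :=
    LinearMap.eqLocus (ε ∘ₗ LinearMap.fst R F₀ P) (q ∘ₗ LinearMap.snd R F₀ P)
  let a : F₁ →ₗ[R] E := LinearMap.codRestrict E (LinearMap.inl R F₀ P ∘ₗ d) fun x => by
    simp [E, hdε.apply_apply_eq_zero]
  let b : Z →ₗ[R] E := LinearMap.codRestrict E (LinearMap.inr R F₀ P ∘ₗ i) fun x => by
    simp [E, hiq.apply_apply_eq_zero]
  have : Module.Flat R E := by
    refine flat_of_exact_of_flat (f := a) (g := LinearMap.snd R F₀ P ∘ₗ E.subtype) ?_ ?_ ?_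
    · intro x y hxy
      exact hd (congrArg (fun z : E => z.1.1) hxy)
    · rintro ⟨⟨x, y⟩, hxy⟩
      constructor
      · intro hy
        obtain rfl : y = 0 := hy
        obtain ⟨z, rfl⟩ := (hdε x).1 (by simpa [E] using hxy)
        exact ⟨z, rfl⟩
      · rintro ⟨z, hz⟩
        exact (congrArg (fun z : E => z.1.2) hz).symm
    · intro y
      obtain ⟨x, hx⟩ := hε (q y)
      exact ⟨⟨(x, y), hx⟩, rfl⟩
  refine flat_ker_of_flat (f := b) (g := LinearMap.fst R F₀ P ∘ₗ E.subtype) ?_ ?_ ?_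
  · intro x y hxy
    exact hi (congrArg (fun z : E => z.1.2) hxy)
  · rintro ⟨⟨x, y⟩, hxy⟩
    constructor
    · intro hx
      obtain rfl : x = 0 := hx
      obtain ⟨z, rfl⟩ := (hiq y).1 (by simpa [E] using hxy.symm)
      exact ⟨z, rfl⟩
    · rintro ⟨z, hz⟩
      exact (congrArg (fun z : E => z.1.1) hz).symm
  · intro x
    obtain ⟨y, hy⟩ := hq (ε x)
    exact ⟨⟨(x, y), hy.symm⟩, rfl⟩

end Flat

/-! ### Flatness of localized modules -/

section Localization

variable {R : Type u} [CommRing R] (S : Submonoid R)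

/-- A localized map is injective if and only if the kernel of the original map vanishes locally. -/
theorem injective_iff_of_isLocalizedModule {M N M' N' : Type*} [AddCommGroup M] [AddCommGroup N]
    [AddCommGroup M'] [AddCommGroup N'] [Module R M] [Module R N] [Module R M'] [Module R N']
    (φ : M →ₗ[R] M') (ψ : N →ₗ[R] N') [IsLocalizedModule S φ] [IsLocalizedModule S ψ]
    (f : M →ₗ[R] N) (g : M' →ₗ[R] N') (h : ∀ x, g (φ x) = ψ (f x)) :
    Function.Injective g ↔ ∀ x, f x = 0 → ∃ s ∈ S, s • x = 0 := by
  constructor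
  · intro hg x hx
    have : φ x = 0 := hg (by rw [h, hx, map_zero, map_zero])
    obtain ⟨s, hs⟩ := (IsLocalizedModule.eq_zero_iff S φ).1 this
    exact ⟨s, s.2, hs⟩
  · intro hf
    rw [injective_iff_map_eq_zero]
    intro z hz
    obtain ⟨⟨x, s⟩, hx⟩ := IsLocalizedModule.surj S φ z
    have h1 : ψ (f x) = 0 := by
      rw [← h, ← hx, Submonoid.smul_def, map_smul, hz, smul_zero]
    obtain ⟨t, ht⟩ := (IsLocalizedModule.eq_zero_iff S ψ).1 h1
    rw [Submonoid.smul_def, ← map_smul] at ht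
    obtain ⟨u, hu, hut⟩ := hf _ ht
    have h2 : φ x = 0 := (IsLocalizedModule.eq_zero_iff S φ).2
      ⟨⟨u, hu⟩ * t, by rw [mul_smul]; exact hut⟩
    rw [h2] at hx
    exact IsLocalizedModule.smul_injective φ s (by simpa using hx)

instance isLocalizedModule_lTensor (X : Type*) [AddCommGroup X] [Module R X] {M M' : Type*}
    [AddCommGroup M] [AddCommGroup M'] [Module R M] [Module R M'] (φ : M →ₗ[R] M')
    [IsLocalizedModule S φ] : IsLocalizedModule S (φ.lTensor X) := by
  have h : φ.lTensor X = (TensorProduct.comm R M' X).toLinearMap ∘ₗ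
      (TensorProduct.AlgebraTensorModule.rTensor R X φ ∘ₗ
        (TensorProduct.comm R X M).toLinearMap) := by
    ext; simp
  rw [h]
  infer_instance

/-- A localization of a flat module is flat over the original ring. -/
theorem flat_localizedModule (S : Submonoid R) (A : Type u) [AddCommGroup A] [Module R A]
    [Module.Flat R A] : Module.Flat R (LocalizedModule S A) :=
  have : Module.Flat R (Localization S) := IsLocalization.flat _ S
  .trans R (Localization S) _

/-- The localization `S⁻¹ A` of the cokernel of `Z ⊆ P`, with `P` flat, is flat if and only if the
kernels of the maps `X ⊗ Z → X ⊗ P` vanish after localization. -/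
theorem flat_localizedModule_iff {Z P A : Type u} [AddCommGroup Z] [AddCommGroup P]
    [AddCommGroup A] [Module R Z] [Module R P] [Module R A] {i : Z →ₗ[R] P} {q : P →ₗ[R] A}
    (hi : Function.Injective i) (hiq : Function.Exact i q) (hq : Function.Surjective q)
    [Module.Flat R P] :
    Module.Flat R (LocalizedModule S A) ↔
      ∀ (X : Type u) [AddCommGroup X] [Module R X] (x : X ⊗[R] Z),
        i.lTensor X x = 0 → ∃ s ∈ S, s • x = 0 := by
  have := flat_localizedModule S P
  let i' := (LocalizedModule.map S i).restrictScalars R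
  let q' := (LocalizedModule.map S q).restrictScalars R
  have hi' : Function.Injective i' := LocalizedModule.map_injective S i hi
  have hq' : Function.Surjective q' := LocalizedModule.map_surjective S q hq
  have hiq' : Function.Exact i' q' := LocalizedModule.map_exact S i q hiq
  have key : ∀ (X : Type u) [AddCommGroup X] [Module R X], Function.Injective (i'.lTensor X) ↔
      ∀ x : X ⊗[R] Z, i.lTensor X x = 0 → ∃ s ∈ S, s • x = 0 := fun X _ _ => by
    refine injective_iff_of_isLocalizedModule S ((LocalizedModule.mkLinearMap S Z).lTensor X)
      ((LocalizedModule.mkLinearMap S P).lTensor X) _ _ fun x => ?_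
    rw [← LinearMap.comp_apply, ← LinearMap.comp_apply, ← LinearMap.lTensor_comp,
      ← LinearMap.lTensor_comp]
    congr 2
    ext z
    simp [i', LocalizedModule.map_mk]
  constructor
  · intro _ X _ _
    exact (key X).1 (lTensor_injective_of_flat_cokernel hi' hiq' hq' X)
  · intro h
    exact flat_of_lTensor_injective hiq' hq' fun X _ _ => (key X).2 (h X)

end Localization

/-! ### Torsion-free modules and ideals over local rings of a domain -/

section Domain

variable {R : Type u} [CommRing R] [IsDomain R]

/-- Torsion-free modules are flat locally at a prime whose local ring is a valuation ring. -/
theorem flat_localizedModule_of_isTorsionFree {p : Ideal R} [p.IsPrime]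
    (hp : ValuationRing (Localization.AtPrime p)) (A : Type u) [AddCommGroup A] [Module R A]
    [Module.IsTorsionFree R A] : Module.Flat R (LocalizedModule p.primeCompl A) := by
  have : IsDomain (Localization.AtPrime p) :=
    IsLocalization.isDomain_localization p.primeCompl_le_nonZeroDivisors
  rw [← Module.flat_iff_of_isLocalization (Localization p.primeCompl) p.primeCompl,
    Module.Flat.flat_iff_torsion_eq_bot_of_isBezout, ← Submodule.isTorsionFree_iff_torsion_eq_bot]
  infer_instance

omit [IsDomain R] in
/-- If `a ⊗ b = b ⊗ a` holds in `I ⊗ I` locally at `p`, for the ideal `I = (a, b)`, then one of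
`a`, `b` divides the other locally at `p`. -/
theorem exists_mul_eq_or_of_tmul_comm {p : Ideal R} [p.IsPrime] {a b s : R}
    (hs : s ∈ p.primeCompl) {I : Ideal R} (hI : I = Ideal.span {a, b}) (ha : a ∈ I) (hb : b ∈ I)
    (h : s • ((⟨a, ha⟩ : I) ⊗ₜ[R] (⟨b, hb⟩ : I) - (⟨b, hb⟩ : I) ⊗ₜ[R] (⟨a, ha⟩ : I)) = 0) :
    ∃ u ∈ p.primeCompl, ∃ e, u * a = e * b ∨ u * b = e * a := by
  -- the equational criterion for vanishing applies, as `a` and `b` generate `I`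
  have hspan : Submodule.span R (Set.range ![(⟨a, ha⟩ : I), ⟨b, hb⟩]) = ⊤ := by
    refine Submodule.map_injective_of_injective I.injective_subtype ?_
    rw [Submodule.map_span, Submodule.map_top, Submodule.range_subtype]
    simpa [Ideal.span, Set.image_insert_eq, Set.pair_comm b a] using hI.symm
  obtain ⟨k, r, y, hr, hrel⟩ := TensorProduct.vanishesTrivially_of_sum_tmul_eq_zero R hspan
    (n := (![s • ⟨b, hb⟩, -(s • ⟨a, ha⟩)] : Fin 2 → I)) (by
      rw [Fin.sum_univ_two]
      change (⟨a, ha⟩ : I) ⊗ₜ[R] (s • (⟨b, hb⟩ : I)) +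
        (⟨b, hb⟩ : I) ⊗ₜ[R] (-(s • (⟨a, ha⟩ : I))) = 0
      rw [TensorProduct.tmul_neg, TensorProduct.tmul_smul, TensorProduct.tmul_smul,
        ← sub_eq_add_neg]
      exact (smul_sub s _ _).symm.trans h)
  have hrel' : ∀ j, r 0 j * a + r 1 j * b = 0 := fun j => by
    simpa using congrArg Subtype.val (hrel j)
  by_cases hp : ∃ j, r 1 j ∉ p
  · obtain ⟨j, hj⟩ := hp
    exact ⟨r 1 j, hj, -r 0 j, .inr (by linear_combination hrel' j)⟩
  push Not at hp
  -- all coefficients of `-s a = ∑ j, r 1 j • y j` lie in `p`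
  choose c d hcd using fun j => Ideal.mem_span_pair.1 (hI ▸ (y j).2 : (y j : R) ∈ Ideal.span {a, b})
  have hsa : -(s * a) = ∑ j, r 1 j * (c j * a + d j * b) := by
    have := congrArg Subtype.val (hr 1)
    simpa [hcd] using this
  refine ⟨s + ∑ j, r 1 j * c j, fun hmem => hs ?_, -∑ j, r 1 j * d j, .inl ?_⟩
  · exact (Submodule.add_mem_iff_left p
      (sum_mem fun j _ => p.mul_mem_right _ (hp j))).1 hmem
  · rw [add_mul, neg_mul, Finset.sum_mul, Finset.sum_mul]
    simp only [mul_add, Finset.sum_add_distrib, ← mul_assoc] at hsa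
    linear_combination -hsa

/-- If the ideals of `R` are flat at `p`, the local ring at `p` is a valuation ring: `a ⊗ b` and
`b ⊗ a` have the same image under `I ⊗ I → I`, which is injective at `p`. -/
theorem valuationRing_localization_of_flat {p : Ideal R} [p.IsPrime]
    (h : ∀ I : Ideal R, Module.Flat R (LocalizedModule p.primeCompl I)) :
    ValuationRing (Localization.AtPrime p) := by
  refine valuationRing_localization_iff.2 fun a b => ?_
  let I := Ideal.span {a, b}
  have ha : a ∈ I := Ideal.subset_span (by simp)
  have hb : b ∈ I := Ideal.subset_span (by simp)
  let φ := LocalizedModule.mkLinearMap p.primeCompl I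
  have := h I
  have hinj : Function.Injective (I.subtype.rTensor (LocalizedModule p.primeCompl I)) :=
    Module.Flat.rTensor_preserves_injective_linearMap _ I.injective_subtype
  obtain ⟨s, hs, h0⟩ := (injective_iff_of_isLocalizedModule p.primeCompl (φ.lTensor I)
    (φ.lTensor R) (I.subtype.rTensor I) _ fun x => by
      rw [← LinearMap.comp_apply, ← LinearMap.comp_apply, LinearMap.rTensor_comp_lTensor,
        LinearMap.lTensor_comp_rTensor]).1 hinj
    ((⟨a, ha⟩ : I) ⊗ₜ[R] (⟨b, hb⟩ : I) - (⟨b, hb⟩ : I) ⊗ₜ[R] (⟨a, ha⟩ : I)) (by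
      refine (TensorProduct.lid R I).injective ?_
      ext
      simp [mul_comm])
  exact exists_mul_eq_or_of_tmul_comm hs rfl ha hb h0

end Domain

/-! ### GV-torsion `Tor` modules -/

section Tor

variable {R : Type u} [CommRing R] [IsDomain R]

omit [IsDomain R] in
theorem isGVTorsion_congr {M N : Type*} [AddCommGroup M] [AddCommGroup N] [Module R M] [Module R N]
    (e : M ≃ₗ[R] N) : IsGVTorsion R M ↔ IsGVTorsion R N := by
  constructor
  · intro h x
    obtain ⟨J, hJ, hx⟩ := h (e.symm x)
    exact ⟨J, hJ, fun a ha => e.symm.injective (by rw [map_smul, hx a ha, map_zero])⟩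
  · intro h x
    obtain ⟨J, hJ, hx⟩ := h (e x)
    exact ⟨J, hJ, fun a ha => e.injective (by rw [map_smul, hx a ha, map_zero])⟩

/-- The homology of a short complex is GV-torsion if and only if its cycles are boundaries locally
at the maximal `w`-ideals. -/
theorem isGVTorsion_homology_iff (S : ShortComplex (ModuleCat.{u} R)) :
    IsGVTorsion R S.homology ↔ ∀ (m : WMax R) (x : S.X₂), S.g.hom x = 0 →
      ∃ s ∈ m.1.primeCompl, ∃ y, S.f.hom y = s • x := by
  rw [isGVTorsion_congr S.moduleCatHomologyIso.toLinearEquiv]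
  change IsGVTorsion R (LinearMap.ker S.g.hom ⧸ LinearMap.range S.moduleCatToCycles) ↔ _
  rw [isGVTorsion_iff]
  refine forall_congr' fun m => ⟨fun h x hx => ?_, fun h z => ?_⟩
  · obtain ⟨s, hs, h0⟩ := h (Submodule.Quotient.mk ⟨x, LinearMap.mem_ker.2 hx⟩)
    rw [← Submodule.Quotient.mk_smul] at h0
    obtain ⟨y, hy⟩ := (Submodule.Quotient.mk_eq_zero _).1 h0
    exact ⟨s, hs, y, congrArg Subtype.val hy⟩
  · obtain ⟨⟨x, hx⟩, rfl⟩ := Submodule.mkQ_surjective _ z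
    obtain ⟨s, hs, y, hy⟩ := h x hx
    refine ⟨s, hs, ?_⟩
    rw [Submodule.mkQ_apply, ← Submodule.Quotient.mk_smul]
    exact (Submodule.Quotient.mk_eq_zero _).2 ⟨y, Subtype.ext hy⟩

/-- With a projective resolution `P` of `N`, and `Z` the image of `P (n + 1) → P n`, the module `Tor
(n + 1) X N` is isomorphic to the kernel of `X ⊗ Z → X ⊗ P n`; so it is GV-torsion if and only if
this kernel vanishes locally at the maximal `w`-ideals. -/
theorem isGVTorsion_tor_succ_iff (X N : ModuleCat.{u} R) (P : ProjectiveResolution N) (n : ℕ) :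
    IsGVTorsion R (((Tor (ModuleCat.{u} R) (n + 1)).obj X).obj N) ↔
      ∀ (m : WMax R) (x : X ⊗[R] LinearMap.range (P.complex.d (n + 1) n).hom),
        (LinearMap.range (P.complex.d (n + 1) n).hom).subtype.lTensor X x = 0 →
          ∃ s ∈ m.1.primeCompl, s • x = 0 := by
  let C := (((MonoidalCategory.tensoringLeft (ModuleCat.{u} R)).obj X).mapHomologicalComplex _).obj
    P.complex
  have e : ((Tor (ModuleCat.{u} R) (n + 1)).obj X).obj N ≅
      (C.sc' (n + 2) (n + 1) n).homology :=
    P.isoLeftDerivedObj _ (n + 1) ≪≫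
      ShortComplex.homologyMapIso (C.isoSc' (n + 2) (n + 1) n (by simp) (by simp))
  rw [isGVTorsion_congr e.toLinearEquiv, isGVTorsion_homology_iff]
  let d₁ := (P.complex.d (n + 2) (n + 1)).hom
  let d₀ := (P.complex.d (n + 1) n).hom
  change (∀ (m : WMax R) (x : X ⊗[R] P.complex.X (n + 1)), d₀.lTensor X x = 0 →
    ∃ s ∈ m.1.primeCompl, ∃ y, d₁.lTensor X y = s • x) ↔ ∀ (m : WMax R)
    (x : X ⊗[R] LinearMap.range d₀), (LinearMap.range d₀).subtype.lTensor X x = 0 →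
      ∃ s ∈ m.1.primeCompl, s • x = 0
  have hd : Function.Exact d₁ d₀ :=
    (ShortComplex.ShortExact.moduleCat_exact_iff_function_exact _).1 (P.exact_succ n)
  have hsurj := LinearMap.surjective_rangeRestrict d₀
  have hex : Function.Exact (d₁.lTensor X) (d₀.rangeRestrict.lTensor X) := by
    refine lTensor_exact X (fun x => ?_) hsurj
    rw [← hd x, ← Subtype.val_inj]
    rfl
  have hcomp : ∀ x, d₀.lTensor X x =
      (LinearMap.range d₀).subtype.lTensor X (d₀.rangeRestrict.lTensor X x) := fun x => by
    rw [← LinearMap.comp_apply, ← LinearMap.lTensor_comp]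
    rfl
  refine forall_congr' fun m => ⟨fun h x hx => ?_, fun h x hx => ?_⟩
  · obtain ⟨y, rfl⟩ := LinearMap.lTensor_surjective X hsurj x
    obtain ⟨s, hs, z, hz⟩ := h y (by rw [hcomp, hx])
    refine ⟨s, hs, ?_⟩
    rw [← map_smul, ← hz]
    exact hex.apply_apply_eq_zero z
  · rw [hcomp] at hx
    obtain ⟨s, hs, h0⟩ := h _ hx
    rw [← map_smul] at h0
    obtain ⟨y, hy⟩ := (hex _).1 h0
    exact ⟨s, hs, y, hy⟩

/-- `Tor (n + 1) X N` is GV-torsion for all `X` if and only if the cokernel of the map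
`P (n + 1) → P n` in a projective resolution of `N` is flat at the maximal `w`-ideals. -/
theorem forall_isGVTorsion_tor_succ_iff (N : ModuleCat.{u} R) (P : ProjectiveResolution N) (n : ℕ)
    {A : Type u} [AddCommGroup A] [Module R A] {q : P.complex.X n →ₗ[R] A}
    (hq : Function.Surjective q) (hdq : Function.Exact (P.complex.d (n + 1) n).hom q) :
    (∀ X : ModuleCat.{u} R, IsGVTorsion R (((Tor (ModuleCat.{u} R) (n + 1)).obj X).obj N)) ↔
      ∀ m : WMax R, Module.Flat R (LocalizedModule m.1.primeCompl A) := by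
  have hproj : Module.Projective R (P.complex.X n) :=
    (IsProjective.iff_projective _).2 (P.projective n)
  have hex : Function.Exact (LinearMap.range (P.complex.d (n + 1) n).hom).subtype q := fun x => by
    rw [hdq x]
    simp
  simp only [isGVTorsion_tor_succ_iff _ N P,
    flat_localizedModule_iff _ (Submodule.injective_subtype _) hex hq]
  exact ⟨fun h m X _ _ => h (ModuleCat.of R X) m, fun h X m => h m X⟩

/-- A module is `w`-flat if and only if it is flat at the maximal `w`-ideals. -/
theorem wFlat_iff (N : ModuleCat.{u} R) :
    WFlat R N ↔ ∀ m : WMax R, Module.Flat R (LocalizedModule m.1.primeCompl N) := by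
  let P := ProjectiveResolution.of N
  refine forall_isGVTorsion_tor_succ_iff N P 0 (q := (P.π.f 0).hom) ?_ ?_
  · exact (ModuleCat.epi_iff_surjective _).1 inferInstance
  · exact (ShortComplex.ShortExact.moduleCat_exact_iff_function_exact _).1 P.exact₀

/-- `Tor₂(X, N)` is GV-torsion for all `X` if and only if, in some short exact sequence
`0 → Ω → P → N → 0` with `P` projective, `Ω` is flat at the maximal `w`-ideals. -/
theorem exists_syzygy_tor_two (N : ModuleCat.{u} R) :
    ∃ (P : Type u) (_ : AddCommGroup P) (_ : Module R P) (Ω : Submodule R P) (q : P →ₗ[R] N),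
      Module.Projective R P ∧ Function.Surjective q ∧ Function.Exact Ω.subtype q ∧
      ((∀ X : ModuleCat.{u} R, IsGVTorsion R (((Tor (ModuleCat.{u} R) 2).obj X).obj N)) ↔
        ∀ m : WMax R, Module.Flat R (LocalizedModule m.1.primeCompl Ω)) := by
  let P := ProjectiveResolution.of N
  have hd : Function.Exact (P.complex.d 2 1).hom (P.complex.d 1 0).hom :=
    (ShortComplex.ShortExact.moduleCat_exact_iff_function_exact _).1 (P.exact_succ 0)
  have hex : Function.Exact (P.complex.d 1 0).hom (P.π.f 0).hom :=
    (ShortComplex.ShortExact.moduleCat_exact_iff_function_exact _).1 P.exact₀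
  refine ⟨P.complex.X 0, inferInstance, inferInstance,
    LinearMap.range (P.complex.d 1 0).hom, (P.π.f 0).hom,
    (IsProjective.iff_projective _).2 (P.projective 0),
    (ModuleCat.epi_iff_surjective _).1 inferInstance, fun x => ?_,
    forall_isGVTorsion_tor_succ_iff N P 1 (LinearMap.surjective_rangeRestrict _) fun x => ?_⟩
  · exact (hex x).trans (by simp)
  · rw [← hd x, ← Subtype.val_inj]
    rfl

end Tor

/-! ### Flat dimension at most one -/

section GlobalDimension

variable {R : Type u} [CommRing R]

theorem flat_localizedModule_ideal (S : Submonoid R) (I : Ideal R) {F₁ F₀ : Type u}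
    [AddCommGroup F₁] [AddCommGroup F₀] [Module R F₁] [Module R F₀] [Module.Flat R F₁]
    [Module.Flat R F₀] {d : F₁ →ₗ[R] F₀} {ε : F₀ →ₗ[R] LocalizedModule S (R ⧸ I)}
    (hd : Function.Injective d) (hdε : Function.Exact d ε) (hε : Function.Surjective ε) :
    Module.Flat R (LocalizedModule S I) := by
  have := flat_localizedModule S R
  exact flat_ker_of_flat_resolution hd hdε hε
    (i := (LocalizedModule.map S I.subtype).restrictScalars R)
    (q := (LocalizedModule.map S I.mkQ).restrictScalars R)
    (LocalizedModule.map_injective S _ I.injective_subtype)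
    (LocalizedModule.map_exact S _ _ (LinearMap.exact_subtype_mkQ I))
    (LocalizedModule.map_surjective S _ I.mkQ_surjective)

variable [IsDomain R]

/-- If all modules `Tor₂(X, R ⧸ I)` are GV-torsion, then `I` is flat at the maximal `w`-ideals. -/
theorem flat_localizedModule_ideal_of_tor_two (I : Ideal R)
    (h : ∀ X : ModuleCat.{u} R,
      IsGVTorsion R (((Tor (ModuleCat.{u} R) 2).obj X).obj (ModuleCat.of R (R ⧸ I))))
    (m : WMax R) : Module.Flat R (LocalizedModule m.1.primeCompl I) := by
  obtain ⟨P, _, _, Ω, q, _, hq, hex, hiff⟩ := exists_syzygy_tor_two (ModuleCat.of R (R ⧸ I))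
  have := hiff.1 h m
  have := flat_localizedModule m.1.primeCompl P
  exact flat_localizedModule_ideal m.1.primeCompl I
    (d := (LocalizedModule.map m.1.primeCompl Ω.subtype).restrictScalars R)
    (ε := (LocalizedModule.map m.1.primeCompl q).restrictScalars R)
    (LocalizedModule.map_injective _ _ Ω.injective_subtype)
    (LocalizedModule.map_exact _ _ _ hex) (LocalizedModule.map_surjective _ _ hq)

theorem wFlatDim_le_one_iff {M : ModuleCat.{u} R} :
    wFlatDim R M ≤ 1 ↔ ∃ n ≤ 1, Nonempty (WFlatResolution R M n) := by
  constructor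
  · intro h
    have h2 : wFlatDim R M < 2 := h.trans_lt (by norm_num)
    simp only [wFlatDim, iInf_lt_iff] at h2
    obtain ⟨n, hn, hlt⟩ := h2
    refine ⟨n, ?_, hn⟩
    have : n < 2 := by exact_mod_cast hlt
    omega
  · rintro ⟨n, hn, h⟩
    exact (iInf₂_le n h).trans (by exact_mod_cast hn)

theorem flat_localizedModule_ideal_of_wFlatDim_le_one {I : Ideal R}
    (h : wFlatDim R (ModuleCat.of R (R ⧸ I)) ≤ 1)
    (m : WMax R) : Module.Flat R (LocalizedModule m.1.primeCompl I) := by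
  obtain ⟨n, hn, ⟨W⟩⟩ := wFlatDim_le_one_iff.1 h
  have := (wFlat_iff _).1 (W.wFlat 0) m
  have := (wFlat_iff _).1 (W.wFlat 1) m
  have hsub : ∀ {A : Type u} [AddCommGroup A] [Module R A] [Subsingleton A],
      Subsingleton (LocalizedModule m.1.primeCompl A) := fun {A} _ _ _ =>
    ⟨fun x y => by
      induction x, y using LocalizedModule.induction_on₂ with
      | _ a b s t => simp [Subsingleton.elim a 0, Subsingleton.elim b 0]⟩
  refine flat_localizedModule_ideal m.1.primeCompl I
    (d := (LocalizedModule.map m.1.primeCompl (W.d 0)).restrictScalars R)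
    (ε := (LocalizedModule.map m.1.primeCompl W.ε).restrictScalars R) ?_ (W.wExact_zero m) ?_
  · have := W.subsingleton 2 (by omega)
    have := hsub (A := W.F 2)
    rw [injective_iff_map_eq_zero]
    intro x hx
    obtain ⟨y, rfl⟩ := (W.wExact_succ 0 m x).1 hx
    rw [Subsingleton.elim y 0, map_zero]
  · have := hsub (A := PUnit.{u + 1})
    exact fun x => (W.wExact_aug m x).1 (Subsingleton.elim _ _)

/-- If torsion-free modules are flat at the maximal `w`-ideals, then free presentations are `w`-flat
resolutions of length one. -/
theorem wFlatDim_le_one_of_isTorsionFree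
    (h : ∀ (A : Type u) [AddCommGroup A] [Module R A] [Module.IsTorsionFree R A] (m : WMax R),
      Module.Flat R (LocalizedModule m.1.primeCompl A)) (M : ModuleCat.{u} R) :
    wFlatDim R M ≤ 1 := by
  let π : (M →₀ R) →ₗ[R] M := Finsupp.linearCombination R id
  have hπ : Function.Surjective π := Finsupp.linearCombination_id_surjective R M
  let F : ℕ → ModuleCat.{u} R
    | 0 => ModuleCat.of R (M →₀ R)
    | 1 => ModuleCat.of R (LinearMap.ker π)
    | _ + 2 => ModuleCat.of R PUnit
  let d : ∀ i, F (i + 1) →ₗ[R] F i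
    | 0 => (LinearMap.ker π).subtype
    | _ + 1 => 0
  refine wFlatDim_le_one_iff.2 ⟨1, le_rfl, ⟨⟨F, d, π, ?_, ?_, ?_, ?_, ?_⟩⟩⟩
  · rintro (_ | _ | i) <;> refine (wFlat_iff _).2 fun m => ?_
    · exact h (M →₀ R) m
    · exact h (LinearMap.ker π) m
    · exact h PUnit m
  · rintro (_ | _ | i) hi
    · omega
    · omega
    · exact inferInstanceAs (Subsingleton PUnit)
  · rintro (_ | i) m
    · refine LocalizedModule.map_exact _ _ _ fun x => ?_
      constructor
      · intro hx
        exact ⟨0, (Subtype.ext hx : x = 0).symm⟩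
      · rintro ⟨y, rfl⟩
        rfl
    · refine LocalizedModule.map_exact _ _ _ fun x => ?_
      exact ⟨fun _ => ⟨0, Subsingleton.elim (α := PUnit) _ _⟩, fun _ => rfl⟩
  · exact fun m => LocalizedModule.map_exact _ _ _ (LinearMap.exact_subtype_ker_map π)
  · refine fun m => LocalizedModule.map_exact _ _ _ fun x => ?_
    exact ⟨fun _ => hπ x, fun _ => rfl⟩

end GlobalDimension

/-! ### Davis maps -/

section Davis

variable {R : Type u} [CommRing R] {K : Type u} [Field K] [Algebra R K]

theorem injective_localizedModule_map_iff (S : Submonoid R) {M N : Type*} [AddCommGroup M]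
    [AddCommGroup N] [Module R M] [Module R N] (f : M →ₗ[R] N) :
    Function.Injective (LocalizedModule.map S f) ↔ ∀ x, f x = 0 → ∃ s ∈ S, s • x = 0 :=
  injective_iff_of_isLocalizedModule S (LocalizedModule.mkLinearMap S M)
    (LocalizedModule.mkLinearMap S N) f ((LocalizedModule.map S f).restrictScalars R) fun x => by
      simp [LocalizedModule.map_mk]

variable [IsDomain R]

theorem isGVTorsion_ker_iff {M N : Type*} [AddCommGroup M] [AddCommGroup N] [Module R M]
    [Module R N] (f : M →ₗ[R] N) :
    IsGVTorsion R (LinearMap.ker f) ↔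
      ∀ m : WMax R, Function.Injective (LocalizedModule.map m.1.primeCompl f) := by
  simp only [isGVTorsion_iff, injective_localizedModule_map_iff, Subtype.forall, LinearMap.mem_ker,
    Subtype.ext_iff, Submodule.coe_smul, ZeroMemClass.coe_zero]

variable [IsFractionRing R K]

omit [IsDomain R] in
/-- A Davis map is injective after localizing at a submonoid at which the second subalgebra is flat:
it is the composite `A ⊗ B → T ⊗ B → T ⊗ S → T ⊗_K S`, whose last two maps are injective because `T`
is flat over `R` and tensor products of `K`-modules over `R` and over `K` agree. -/
theorem injective_map_davisMap_of_flat (M : Submonoid R) {T S : Type u} [Ring T] [Ring S]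
    [Algebra K T] [Algebra K S] [Algebra R T] [Algebra R S]
    [IsScalarTower R K T] [IsScalarTower R K S]
    (A : Subalgebra R T) (B : Subalgebra R S) [Module.Flat R (LocalizedModule M B)] :
    Function.Injective (LocalizedModule.map M (davisMap K A B)) := by
  have : Module.Flat R K := IsLocalization.flat K R⁰
  have : Module.Flat R T := .trans R K T
  have hcompat : TensorProduct.CompatibleSMul R K T S :=
    IsLocalization.tensorProduct_compatibleSMul R⁰ K T S
  have h₁ : Function.Injective (TensorProduct.mapOfCompatibleSMul K R R T S) :=
    (TensorProduct.equivOfCompatibleSMul K R R T S).injective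
  have h₂ : Function.Injective (B.val.toLinearMap.lTensor T) :=
    Module.Flat.lTensor_preserves_injective_linearMap _ Subtype.val_injective
  have h₃ : Function.Injective (A.val.toLinearMap.rTensor (LocalizedModule M B)) :=
    Module.Flat.rTensor_preserves_injective_linearMap _ Subtype.val_injective
  let φ := LocalizedModule.mkLinearMap M B
  refine (injective_localizedModule_map_iff _ _).2 fun x hx => ?_
  refine (injective_iff_of_isLocalizedModule M (φ.lTensor A) (φ.lTensor T)
    (A.val.toLinearMap.rTensor B) _ fun x => ?_).1 h₃ x (h₂ (h₁ ?_))
  · rw [← LinearMap.comp_apply, ← LinearMap.comp_apply, LinearMap.rTensor_comp_lTensor,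
      LinearMap.lTensor_comp_rTensor]
  · rw [map_zero, map_zero, ← LinearMap.comp_apply (B.val.toLinearMap.lTensor T),
      LinearMap.lTensor_comp_rTensor]
    exact hx

variable (K) in
/-- The subalgebra `R + I ε` of the dual numbers `K[ε]`, for an ideal `I` of `R`. The dual numbers
are the trivial square-zero extension of `K` by `K`, in which `i ε` is `TrivSqZeroExt.inr i`. -/
def dualNumberSubalgebra (I : Ideal R) : Subalgebra R (TrivSqZeroExt K K) where
  carrier := {x | (∃ r : R, algebraMap R K r = x.fst) ∧ ∃ i ∈ I, algebraMap R K i = x.snd}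
  mul_mem' := by
    rintro x y ⟨⟨r, hr⟩, i, hi, hi'⟩ ⟨⟨s, hs⟩, j, hj, hj'⟩
    refine ⟨⟨r * s, by simp [hr, hs]⟩, r * j + s * i,
      I.add_mem (I.mul_mem_left _ hj) (I.mul_mem_left _ hi), ?_⟩
    simp [hr, hs, hi', hj', mul_comm]
  add_mem' := by
    rintro x y ⟨⟨r, hr⟩, i, hi, hi'⟩ ⟨⟨s, hs⟩, j, hj, hj'⟩
    exact ⟨⟨r + s, by simp [hr, hs]⟩, i + j, I.add_mem hi hj, by simp [hi', hj']⟩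
  algebraMap_mem' r := ⟨⟨r, rfl⟩, 0, I.zero_mem, map_zero _⟩

omit [Algebra R K] [IsDomain R] [IsFractionRing R K] in
theorem inr_tmul_inr_comm (x y : K) :
    (TrivSqZeroExt.inr x : TrivSqZeroExt K K) ⊗ₜ[K] (TrivSqZeroExt.inr y : TrivSqZeroExt K K) =
      (TrivSqZeroExt.inr y : TrivSqZeroExt K K) ⊗ₜ[K]
        (TrivSqZeroExt.inr x : TrivSqZeroExt K K) := by
  have h : ∀ z : K, (TrivSqZeroExt.inr z : TrivSqZeroExt K K) =
      z • (TrivSqZeroExt.inr 1 : TrivSqZeroExt K K) := fun z => by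
    rw [← TrivSqZeroExt.inr_smul, smul_eq_mul, mul_one]
  rw [h x, h y, TensorProduct.smul_tmul_smul, TensorProduct.smul_tmul_smul, mul_comm]

variable (K) in
/-- The inclusion `I → R + I ε`, `i ↦ i ε`. -/
def dualNumberInr (I : Ideal R) : I →ₗ[R] dualNumberSubalgebra K I :=
  LinearMap.codRestrict (dualNumberSubalgebra K I).toSubmodule
    ((TrivSqZeroExt.inrHom K K).restrictScalars R ∘ₗ Algebra.linearMap R K ∘ₗ I.subtype)
    fun i => ⟨⟨0, map_zero _⟩, i, i.2, rfl⟩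

variable (K) in
/-- The projection `R + I ε → I`, `r + i ε ↦ i`. -/
noncomputable def dualNumberSnd (I : Ideal R) : dualNumberSubalgebra K I →ₗ[R] I :=
  (Submodule.equivMapOfInjective (Algebra.linearMap R K)
    (IsFractionRing.injective R K) I).symm.toLinearMap ∘ₗ
  LinearMap.codRestrict _
    ((TrivSqZeroExt.sndHom K K).restrictScalars R ∘ₗ (dualNumberSubalgebra K I).val.toLinearMap)
    fun x => x.2.2

omit [IsDomain R] in
theorem dualNumberSnd_inr (I : Ideal R) (i : I) :
    dualNumberSnd K I (dualNumberInr K I i) = i :=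
  (Submodule.equivMapOfInjective (Algebra.linearMap R K)
    (IsFractionRing.injective R K) I).symm_apply_eq.2 rfl

omit [IsDomain R] [IsFractionRing R K] in
theorem davisMap_dualNumberInr_comm (I : Ideal R) (i j : I) :
    davisMap K (dualNumberSubalgebra K I) (dualNumberSubalgebra K I)
      (dualNumberInr K I i ⊗ₜ[R] dualNumberInr K I j -
        dualNumberInr K I j ⊗ₜ[R] dualNumberInr K I i) = 0 := by
  rw [map_sub, sub_eq_zero]
  exact inr_tmul_inr_comm (algebraMap R K i) (algebraMap R K j)

omit [IsDomain R] [IsFractionRing R K] in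
/-- The argument for `A = R + I ε`, with only the properties of `A` that it needs: `I` is a direct
summand of `A` as a module, and the elements `x ⊗ y - y ⊗ x` with `x`, `y` in `I` lie in the kernel
of the Davis map. -/
theorem exists_mul_eq_or_of_davisMap {p : Ideal R} [p.IsPrime] {T : Type u} [Ring T] [Algebra K T]
    [Algebra R T] [IsScalarTower R K T] {A : Subalgebra R T}
    (h : Function.Injective (LocalizedModule.map p.primeCompl (davisMap K A A))) {a b : R}
    (ι : Ideal.span {a, b} →ₗ[R] A) (π : A →ₗ[R] Ideal.span {a, b}) (hπ : ∀ i, π (ι i) = i)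
    (hι : ∀ i j, davisMap K A A (ι i ⊗ₜ[R] ι j - ι j ⊗ₜ[R] ι i) = 0) :
    ∃ u ∈ p.primeCompl, ∃ e, u * a = e * b ∨ u * b = e * a := by
  have ha : a ∈ Ideal.span {a, b} := Ideal.subset_span (by simp)
  have hb : b ∈ Ideal.span {a, b} := Ideal.subset_span (by simp)
  obtain ⟨s, hs, h0⟩ := (injective_localizedModule_map_iff _ _).1 h _ (hι ⟨a, ha⟩ ⟨b, hb⟩)
  refine exists_mul_eq_or_of_tmul_comm hs rfl ha hb ?_
  have := congrArg (TensorProduct.map π π) h0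
  rwa [map_smul, map_sub, TensorProduct.map_tmul, TensorProduct.map_tmul, hπ, hπ, map_zero] at this

/-- If the Davis maps of the algebras `A = R + I ε` with themselves are injective at `p`, the local
ring at `p` is a valuation ring: for `I = (a, b)`, the element `aε ⊗ bε - bε ⊗ aε` of the kernel
projects to `a ⊗ b - b ⊗ a` in `I ⊗ I`. -/
theorem valuationRing_localization_of_davisMap {p : Ideal R} [p.IsPrime]
    (h : ∀ I : Ideal R, Function.Injective (LocalizedModule.map p.primeCompl
      (davisMap K (dualNumberSubalgebra K I) (dualNumberSubalgebra K I)))) :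
    ValuationRing (Localization.AtPrime p) :=
  valuationRing_localization_iff.2 fun _ _ =>
    exists_mul_eq_or_of_davisMap (h _) (dualNumberInr K _) (dualNumberSnd K _)
      (dualNumberSnd_inr _) (davisMap_dualNumberInr_comm _)

end Davis

end WModule

theorem theorem3p2 {R : Type u} [CommRing R] [IsDomain R]
    {K : Type u} [Field K] [Algebra R K] [IsFractionRing R K] :
    List.TFAE [
      -- (1) `R` is a PvMD
      WModule.IsPvMD R,
      -- (2) `Tor₂(M, N)` is always GV-torsion
      ∀ M N : ModuleCat.{u} R,
        WModule.IsGVTorsion R (((Tor (ModuleCat.{u} R) 2).obj M).obj N),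
      -- (2') the `w`-weak global dimension is at most one
      WModule.wWeakGlobalDim R ≤ 1,
      -- (3) `Tor₁(X, A)` is GV-torsion for torsion-free `A`
      ∀ X A : ModuleCat.{u} R, Module.IsTorsionFree R A →
        WModule.IsGVTorsion R (((Tor (ModuleCat.{u} R) 1).obj X).obj A),
      -- (4) every Davis map has GV-torsion kernel
      ∀ (T S : Type u) [Ring T] [Ring S] [Algebra K T] [Algebra K S] [Algebra R T] [Algebra R S]
        [IsScalarTower R K T] [IsScalarTower R K S] (A : Subalgebra R T) (B : Subalgebra R S),
        WModule.IsGVTorsion R (LinearMap.ker (WModule.davisMap K A B)),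
      -- (4') every Davis map is injective at each maximal `w`-ideal
      ∀ (T S : Type u) [Ring T] [Ring S] [Algebra K T] [Algebra K S] [Algebra R T] [Algebra R S]
        [IsScalarTower R K T] [IsScalarTower R K S] (A : Subalgebra R T) (B : Subalgebra R S),
        ∀ m : WModule.WMax R, Function.Injective
          (LocalizedModule.map m.1.primeCompl (WModule.davisMap K A B))] ∧
    -- the two conditions on the Davis map are equivalent for each pair `A`, `B`
    ∀ (T S : Type u) [Ring T] [Ring S] [Algebra K T] [Algebra K S] [Algebra R T] [Algebra R S]
      [IsScalarTower R K T] [IsScalarTower R K S] (A : Subalgebra R T) (B : Subalgebra R S),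
      WModule.IsGVTorsion R (LinearMap.ker (WModule.davisMap K A B)) ↔
        ∀ m : WModule.WMax R, Function.Injective
          (LocalizedModule.map m.1.primeCompl (WModule.davisMap K A B)) := by
  refine ⟨?_, fun T S _ _ _ _ _ _ _ _ A B => WModule.isGVTorsion_ker_iff _⟩
  -- if `R` is a PvMD, torsion-free modules are flat at the maximal `w`-ideals
  have hflat : WModule.IsPvMD R → ∀ (A : Type u) [AddCommGroup A] [Module R A]
      [Module.IsTorsionFree R A] (m : WModule.WMax R),
      Module.Flat R (LocalizedModule m.1.primeCompl A) := fun h A _ _ _ m =>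
    WModule.flat_localizedModule_of_isTorsionFree (WModule.isPvMD_iff.1 h m) A
  -- conversely, it suffices that the ideals are flat at the maximal `w`-ideals
  have hideal : (∀ (I : Ideal R) (m : WModule.WMax R),
      Module.Flat R (LocalizedModule m.1.primeCompl I)) → WModule.IsPvMD R := fun h =>
    WModule.isPvMD_iff.2 fun m => WModule.valuationRing_localization_of_flat fun I => h I m
  tfae_have 1 → 2 := fun h M N => by
    obtain ⟨P, _, _, Ω, q, _, -, -, hiff⟩ := WModule.exists_syzygy_tor_two N
    exact hiff.2 (hflat h Ω) M
  tfae_have 2 → 1 := fun h =>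
    hideal fun I => WModule.flat_localizedModule_ideal_of_tor_two I fun X => h X _
  tfae_have 1 → 3 := fun h => iSup_le (WModule.wFlatDim_le_one_of_isTorsionFree (hflat h))
  tfae_have 3 → 1 := fun h => hideal fun I =>
    WModule.flat_localizedModule_ideal_of_wFlatDim_le_one ((le_iSup _ _).trans h)
  tfae_have 1 → 4 := fun h X A _ => (WModule.wFlat_iff A).2 (hflat h A) X
  tfae_have 4 → 1 := fun h => hideal fun I =>
    (WModule.wFlat_iff (ModuleCat.of R I)).1 fun X => h X _ inferInstance
  tfae_have 5 ↔ 6 := by simp only [WModule.isGVTorsion_ker_iff]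
  tfae_have 1 → 6 := fun h T S _ _ _ _ _ _ _ _ A B m => by
    have : Module.Flat R K := IsLocalization.flat K R⁰
    have : Module.Flat R S := .trans R K S
    have : Module.IsTorsionFree R B := inferInstanceAs (Module.IsTorsionFree R B.toSubmodule)
    have := hflat h B m
    exact WModule.injective_map_davisMap_of_flat _ A B
  tfae_have 6 → 1 := fun h => WModule.isPvMD_iff.2 fun m =>
    WModule.valuationRing_localization_of_davisMap (K := K) fun I => h _ _ _ _ m
  tfae_finish
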